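/- Let $K_{n,2}$ be the Kneser graph whose vertices are the $2$-element subsets of $\{1,\dots,n\}$, two of them being adjacent if and only if they are disjoint. For a finite simple graph $G=(V,E)$, a signed Roman dominating function is a function $f:V\to\{-1,1,2\}$ such that every vertex $v$ with $f(v)=-1$ is adjacent to some vertex $u$ with $f(u)=2$, and such that $\sum_{u\in N[v]}f(u)\ge 1$ for every $v\in V$, where $N[v]$ is the closed neighbourhood of $v$. The signed Roman domination number $\gamma_{sR}(G)$ is the minimum of $\sum_{v\in V}f(v)$ over all signed Roman dominating functions $f$ on $G$. For every integer $n\ge 12$: \begin{itemize} \item if $n$ is odd, then $2\le\gamma_{sR}(K_{n,2})\le 3$; \item if $n$ is even, then $2\le\gamma_{sR}(K_{n,2})\le 5$. \end{itemize} -/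

import Mathlib

/-- The Kneser graph `K_{n,k}`: the vertices are the `k`-element subsets of an `n`-element set, and
two vertices are adjacent when they are disjoint. (The clause `s ≠ t` only matters for `k = 0`,
where it prevents a loop at the empty set.) -/
def kneserGraph (n k : ℕ) : SimpleGraph {s : Finset (Fin n) // s.card = k} where
  Adj s t := s ≠ t ∧ Disjoint s.1 t.1
  symm := ⟨fun _ _ h => ⟨h.1.symm, h.2.symm⟩⟩
  loopless := ⟨fun _ h => h.1 rfl⟩

instance kneserGraph.decidableAdj (n k : ℕ) : DecidableRel (kneserGraph n k).Adj :=
  fun s t => inferInstanceAs (Decidable (s ≠ t ∧ Disjoint s.1 t.1))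

/-- A signed Roman dominating function on a finite graph `G`. -/
structure IsSignedRomanDominating {V : Type*} [Fintype V] [DecidableEq V] (G : SimpleGraph V)
    [DecidableRel G.Adj] (f : V → ℤ) : Prop where
  /-- `f` takes values in `{-1, 1, 2}`. -/
  values : ∀ v, f v = -1 ∨ f v = 1 ∨ f v = 2
  /-- Every vertex labelled `-1` has a neighbour labelled `2`. -/
  exists_adj : ∀ v, f v = -1 → ∃ u, G.Adj v u ∧ f u = 2
  /-- The sum of `f` over every closed neighbourhood `N[v]` is at least `1`. -/
  one_le_sum : ∀ v, 1 ≤ ∑ u ∈ insert v (G.neighborFinset v), f u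

/-- The weights `∑ v, f v` of the signed Roman dominating functions `f` on `G`. -/
def signedRomanWeights {V : Type*} [Fintype V] [DecidableEq V] (G : SimpleGraph V)
    [DecidableRel G.Adj] : Set ℤ :=
  {w | ∃ f : V → ℤ, IsSignedRomanDominating G f ∧ ∑ v, f v = w}

/-- The signed Roman domination number of a finite graph: the minimum weight of a signed Roman
dominating function. -/
noncomputable def signedRomanDominationNumber {V : Type*} [Fintype V] [DecidableEq V]
    (G : SimpleGraph V) [DecidableRel G.Adj] : ℤ :=
  sInf (signedRomanWeights G)

/-- The infimum in the definition of the signed Roman domination number is a minimum, for every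
finite graph. -/
theorem signedRomanDominationNumber_isLeast {V : Type*} [Fintype V] [DecidableEq V]
    (G : SimpleGraph V) [DecidableRel G.Adj] :
    IsLeast (signedRomanWeights G) (signedRomanDominationNumber G) := by
  have hne : (signedRomanWeights G).Nonempty := by
    refine ⟨_, fun _ => 1, ⟨fun _ => Or.inr (Or.inl rfl), fun _ h => by norm_num at h, fun v => ?_⟩,
      rfl⟩
    simp
  have hbdd : BddBelow (signedRomanWeights G) := by
    refine ⟨∑ _v : V, (-1 : ℤ), ?_⟩
    rintro w ⟨f, hf, rfl⟩
    refine Finset.sum_le_sum fun v _ => ?_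
    rcases hf.values v with h | h | h <;> rw [h] <;> norm_num
  exact ⟨Int.csInf_mem hne hbdd, fun w hw => csInf_le hbdd hw⟩

open Finset

namespace KneserTwo

/-! Closed neighbourhood sums depend only on the weight W, the star sums at the two points and the
label of the pair. Lower bound (`two_le_weight`): adding the n(n-1)/2 inequalities counts each label
once per closed neighbourhood containing it. These have fewer than n(n-1)/2 elements, so W > 1.
Upper bound: give the points signs with total t ≥ 0 and label a pair by the product of its signs.
Then raise k edges of a cycle on the negative points from 1 to 2. This gives 2W = t² - n + 2k, while
degrees at most 2 in the cycle keep every star sum small. The conditions reduce to W ≥ 3, 2t ≤ W + 3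
and k ≥ 3. -/

/-- The vertices of `K_{n,2}`. -/
abbrev Pair (n : ℕ) : Type := {s : Finset (Fin n) // s.card = 2}

/-! ### Star sums and double counting -/

/-- The sum of `f` over the pairs that contain `x`. -/
def starSum {n : ℕ} (f : Pair n → ℤ) (x : Fin n) : ℤ :=
  ∑ v, if x ∈ v.1 then f v else 0

theorem sum_starSum_mul {n : ℕ} (f : Pair n → ℤ) (g : Fin n → ℤ) :
    ∑ x, starSum f x * g x = ∑ v, f v * ∑ x ∈ v.1, g x := by
  simp only [starSum, sum_mul, mul_sum]
  rw [sum_comm]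
  refine sum_congr rfl fun v _ => ?_
  simp only [ite_mul, zero_mul]
  rw [← sum_filter]
  congr 1
  ext x
  simp

theorem sum_starSum {n : ℕ} (f : Pair n → ℤ) : ∑ x, starSum f x = 2 * ∑ v, f v := by
  have h := sum_starSum_mul f fun _ => 1
  simp only [mul_one] at h
  rw [h, mul_sum]
  refine sum_congr rfl fun v _ => ?_
  simp [v.2, mul_comm]

/-- A sum over the pairs through `x` is a sum over the points different from `x`. -/
theorem starSum_eq_sum_erase {n : ℕ} (F : Finset (Fin n) → ℤ) (x : Fin n) :
    starSum (fun v => F v.1) x = ∑ y ∈ univ.erase x, F {x, y} := by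
  rw [starSum, ← sum_filter]
  symm
  refine sum_bij (fun y hy => ⟨{x, y}, card_pair (ne_of_mem_erase hy).symm⟩) ?_ ?_ ?_ ?_
  · intro y _
    simp
  · intro y hy z hz h
    have hy' := ne_of_mem_erase hy
    have h' : y ∈ ({x, z} : Finset (Fin n)) := by
      rw [← show ({x, y} : Finset (Fin n)) = {x, z} from congrArg Subtype.val h]
      simp
    simpa [hy'] using h'
  · intro v hv
    obtain ⟨a, b, hab, hv'⟩ := card_eq_two.1 v.2
    have hx : x ∈ v.1 := (mem_filter.1 hv).2
    rw [hv', mem_insert, mem_singleton] at hx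
    rcases hx with rfl | rfl
    · exact ⟨b, by simp [hab.symm], Subtype.ext hv'.symm⟩
    · exact ⟨a, by simp [hab], Subtype.ext ((pair_comm _ _).trans hv'.symm)⟩
  · intro y _
    rfl

/-- The closed neighbourhood sums of `K_{n,2}` in terms of the star sums. -/
theorem sum_closedNeighbor {n : ℕ} (f : Pair n → ℤ) (v : Pair n) :
    ∑ u ∈ insert v ((kneserGraph n 2).neighborFinset v), f u =
      ∑ u, f u - ∑ x ∈ v.1, starSum f x + 2 * f v := by
  obtain ⟨x, y, hxy, hv⟩ := card_eq_two.1 v.2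
  have h2 : 2 * f v = ∑ u, if u = v then 2 * f u else 0 := by simp
  have h1 : ∑ u ∈ insert v ((kneserGraph n 2).neighborFinset v), f u =
      ∑ u, if u ∈ insert v ((kneserGraph n 2).neighborFinset v) then f u else 0 := by
    rw [← sum_filter, filter_mem_eq_inter, univ_inter]
  rw [hv, sum_pair hxy, starSum, starSum, h2, h1, ← sum_add_distrib, ← sum_sub_distrib,
    ← sum_add_distrib]
  refine sum_congr rfl fun u _ => ?_
  -- The term 2 f(v) corrects for v being subtracted in both stars; no other pair lies in both.
  by_cases huv : u = v
  · have hx : x ∈ u.1 := by simp [huv, hv]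
    have hy : y ∈ u.1 := by simp [huv, hv]
    simp only [huv, mem_insert, true_or, if_true]
    simp only [← huv, hx, hy, if_true]
    ring
  · have hadj : u ∈ insert v ((kneserGraph n 2).neighborFinset v) ↔ x ∉ u.1 ∧ y ∉ u.1 := by
      rw [mem_insert, or_iff_right huv, SimpleGraph.mem_neighborFinset]
      change (v ≠ u ∧ Disjoint v.1 u.1) ↔ _
      rw [and_iff_right (Ne.symm huv), hv, disjoint_insert_left, disjoint_singleton_left]
    have hnot : ¬ (x ∈ u.1 ∧ y ∈ u.1) := fun h => huv <| Subtype.ext <| by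
      refine (eq_of_subset_of_card_le ?_ (by rw [u.2, v.2])).symm
      rw [hv, insert_subset_iff, singleton_subset_iff]
      exact h
    simp only [hadj, huv, if_false]
    by_cases hx : x ∈ u.1 <;> by_cases hy : y ∈ u.1 <;> simp_all

/-! ### Lower bound -/

/-- Any function whose closed neighbourhood sums in `K_{n,2}` are all positive has weight at
least `2`. -/
theorem two_le_weight {n : ℕ} (hn : 4 ≤ n) (f : Pair n → ℤ)
    (hf : ∀ v, 1 ≤ ∑ u ∈ insert v ((kneserGraph n 2).neighborFinset v), f u) :
    2 ≤ ∑ v, f v := by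
  have hstar (x : Fin n) : starSum (fun _ : Pair n => 1) x = n - 1 := by
    rw [starSum_eq_sum_erase (fun _ => 1) x]
    simp [card_erase_of_mem, Nat.cast_sub (show 1 ≤ n by omega)]
  have hcount : 2 * (Fintype.card (Pair n) : ℤ) = n * (n - 1) := by
    have h := sum_starSum (fun _ : Pair n => 1)
    simp only [hstar] at h
    rw [sum_const, sum_const] at h
    simpa [-Fintype.card_finset_len] using h.symm
  have hdouble : ∑ v : Pair n, ∑ x ∈ v.1, starSum f x = (n - 1) * (2 * ∑ v, f v) := by
    have h := sum_starSum_mul (fun _ : Pair n => 1) (starSum f)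
    simp only [hstar, one_mul] at h
    rw [← h, ← mul_sum, sum_starSum]
  have hsum : (Fintype.card (Pair n) : ℤ) ≤
      Fintype.card (Pair n) * ∑ v, f v - (n - 1) * (2 * ∑ v, f v) + 2 * ∑ v, f v := by
    calc (Fintype.card (Pair n) : ℤ) = ∑ _v : Pair n, 1 := by simp
      _ ≤ ∑ v, (∑ u, f u - ∑ x ∈ v.1, starSum f x + 2 * f v) :=
        sum_le_sum fun v _ => sum_closedNeighbor f v ▸ hf v
      _ = _ := by
        rw [sum_add_distrib, sum_sub_distrib, hdouble, ← mul_sum]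
        simp
  have hn' : (4 : ℤ) ≤ n := by exact_mod_cast hn
  by_contra! hW
  have hW' : ∑ v, f v ≤ 1 := by omega
  -- The second factor is twice the size of a closed neighbourhood, and is below n(n-1) because 4n >
  -- 8.
  nlinarith [mul_nonneg (sub_nonneg.2 hW') (show (0 : ℤ) ≤ n * (n - 1) - 4 * n + 8 by nlinarith)]

/-! ### Signed labellings -/

/-- The label of a pair in the construction: the product of the signs of its points, raised by
`1` on the pairs in `T`. -/
def label {n : ℕ} (ε : Fin n → ℤ) (T : Finset (Pair n)) (v : Pair n) : ℤ :=
  ∏ x ∈ v.1, ε x + if v ∈ T then 1 else 0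

/-- The products through x add up to ε(x)(S - ε(x)) with S the sum of all signs, and ε(x)² = 1. -/
theorem starSum_label {n : ℕ} {ε : Fin n → ℤ} (hε : ∀ x, ε x = 1 ∨ ε x = -1)
    (T : Finset (Pair n)) (x : Fin n) :
    starSum (label ε T) x = ε x * ∑ y, ε y - 1 + #{v ∈ T | x ∈ v.1} := by
  have hsplit : starSum (label ε T) x =
      starSum (fun v => ∏ y ∈ v.1, ε y) x + ∑ v, if v ∈ T ∧ x ∈ v.1 then 1 else 0 := by
    rw [starSum, starSum, ← sum_add_distrib]
    refine sum_congr rfl fun v _ => ?_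
    by_cases hv : v ∈ T <;> by_cases hx : x ∈ v.1 <;> simp [label, hv, hx]
  have hprod : starSum (fun v => ∏ y ∈ v.1, ε y) x = ε x * ∑ y, ε y - 1 := by
    rw [starSum_eq_sum_erase (fun s => ∏ y ∈ s, ε y) x,
      sum_congr rfl fun y hy => prod_pair (ne_of_mem_erase hy).symm, ← mul_sum,
      ← add_sum_erase univ ε (mem_univ x)]
    have hsq : ε x * ε x = 1 := by rcases hε x with h | h <;> rw [h] <;> norm_num
    linear_combination -hsq
  rw [hsplit, hprod, sum_boole]
  congr 3
  ext v
  simp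

theorem two_mul_sum_label {n : ℕ} {ε : Fin n → ℤ} (hε : ∀ x, ε x = 1 ∨ ε x = -1)
    (T : Finset (Pair n)) :
    2 * ∑ v, label ε T v = (∑ x, ε x) ^ 2 - n + 2 * #T := by
  have hT : ∑ x : Fin n, (#{v ∈ T | x ∈ v.1} : ℤ) = 2 * #T := by
    have h := sum_starSum (fun v : Pair n => if v ∈ T then (1 : ℤ) else 0)
    have h' : ∑ v : Pair n, (if v ∈ T then (1 : ℤ) else 0) = #T := by simp
    rw [← h', ← h]
    refine sum_congr rfl fun x _ => ?_
    rw [starSum, ← sum_filter, ← sum_filter, sum_const, filter_filter]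
    simp only [nsmul_eq_mul, mul_one]
    congr 2
    ext v
    simp [and_comm]
  rw [← sum_starSum]
  simp only [starSum_label hε, sum_add_distrib, sum_sub_distrib, ← sum_mul, hT]
  simp
  ring

/-- Conditions under which the labelling is a signed Roman dominating function. -/
theorem isSignedRomanDominating_label {n : ℕ} {ε : Fin n → ℤ} (hε : ∀ x, ε x = 1 ∨ ε x = -1)
    {T : Finset (Pair n)} (hT : ∀ v ∈ T, ∀ x ∈ v.1, ε x = -1)
    (hdeg : ∀ x, #{v ∈ T | x ∈ v.1} ≤ 2) (hcard : 3 ≤ #T) (hS : 0 ≤ ∑ x, ε x)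
    (hW : 3 ≤ ∑ v, label ε T v) (hWS : 2 * ∑ x, ε x ≤ ∑ v, label ε T v + 3) :
    IsSignedRomanDominating (kneserGraph n 2) (label ε T) := by
  have hpair (v : Pair n) : (∀ x ∈ v.1, ε x = 1) ∨ (∀ x ∈ v.1, ε x = -1) ∨
      ∃ x y, x ≠ y ∧ v.1 = {x, y} ∧ ε x = -1 ∧ ε y = 1 := by
    obtain ⟨x, y, hxy, hv⟩ := card_eq_two.1 v.2
    rcases hε x with hx | hx <;> rcases hε y with hy | hy
    · left; simp [hv, hx, hy]
    · exact .inr (.inr ⟨y, x, hxy.symm, hv.trans (pair_comm _ _), hy, hx⟩)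
    · exact .inr (.inr ⟨x, y, hxy, hv, hx, hy⟩)
    · right; left; simp [hv, hx, hy]
  have hTval {v : Pair n} (hv : v ∈ T) : label ε T v = 2 := by
    rw [label, prod_congr rfl (hT v hv), prod_const, v.2, if_pos hv]
    norm_num
  have hone {v : Pair n} (hv : ∀ x ∈ v.1, ε x = 1) : label ε T v = 1 := by
    have hvT : v ∉ T := fun h => by
      obtain ⟨x, hx⟩ := card_pos.1 (v.2.symm ▸ two_pos)
      have := hv x hx
      rw [hT v h x hx] at this
      norm_num at this
    rw [label, prod_congr rfl hv, prod_const_one, if_neg hvT, add_zero]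
  have hneg {v : Pair n} (hv : ∀ x ∈ v.1, ε x = -1) : label ε T v = 1 ∨ label ε T v = 2 := by
    by_cases hvT : v ∈ T
    · exact .inr (hTval hvT)
    · left
      rw [label, prod_congr rfl hv, prod_const, v.2, if_neg hvT]
      norm_num
  have hmix {v : Pair n} {x y : Fin n} (hxy : x ≠ y) (hv : v.1 = {x, y}) (hx : ε x = -1)
      (hy : ε y = 1) : label ε T v = -1 := by
    have hvT : v ∉ T := fun h => by
      have := hT v h y (by simp [hv])
      rw [hy] at this
      norm_num at this
    rw [label, hv, prod_pair hxy, hx, hy, if_neg hvT]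
    norm_num
  have hstar1 {x : Fin n} (hx : ε x = 1) : starSum (label ε T) x = ∑ y, ε y - 1 := by
    have h0 : ({v ∈ T | x ∈ v.1} : Finset (Pair n)) = ∅ := by
      refine filter_eq_empty_iff.2 fun v hv hxv => ?_
      have := hT v hv x hxv
      rw [hx] at this
      norm_num at this
    rw [starSum_label hε, hx, h0]
    simp
  have hstar2 {x : Fin n} (hx : ε x = -1) : starSum (label ε T) x ≤ 1 - ∑ y, ε y := by
    have := hdeg x
    rw [starSum_label hε, hx]
    omega
  refine ⟨fun v => ?_, fun v hv => ?_, fun v => ?_⟩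
  · rcases hpair v with h | h | ⟨x, y, hxy, h, hx, hy⟩
    · exact .inr (.inl (hone h))
    · exact .inr (hneg h)
    · exact .inl (hmix hxy h hx hy)
  · rcases hpair v with h | h | ⟨x, y, hxy, h, hx, hy⟩
    · have := hone h
      omega
    · have := hneg h
      omega
    -- At most two of the three or more pairs in T meet x, and none meets the positive point y.
    · obtain ⟨u, hu, hxu⟩ : ∃ u ∈ T, x ∉ u.1 := by
        by_contra! hall
        have := hdeg x
        rw [filter_true_of_mem hall] at this
        omega
      have hyu : y ∉ u.1 := fun hyu => by
        have := hT u hu y hyu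
        rw [hy] at this
        norm_num at this
      refine ⟨u, ⟨?_, ?_⟩, hTval hu⟩
      · rintro rfl
        exact hxu (by simp [h])
      · rw [h]
        simp [hxu, hyu]
  · rw [sum_closedNeighbor]
    -- With S the sum of the signs, the neighbourhood sum is W - 2S + 4 on positive pairs, at least
    -- W + 2S on negative ones and at least W - 2 on mixed ones.
    rcases hpair v with h | h | ⟨x, y, hxy, h, hx, hy⟩
    · rw [sum_congr rfl fun x hx => hstar1 (h x hx), sum_const, v.2, hone h]
      simp only [nsmul_eq_mul, Nat.cast_ofNat]
      omega
    · have h1 : ∑ x ∈ v.1, starSum (label ε T) x ≤ ∑ _x ∈ v.1, (1 - ∑ y, ε y) :=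
        sum_le_sum fun x hx => hstar2 (h x hx)
      rw [sum_const, v.2] at h1
      simp only [nsmul_eq_mul, Nat.cast_ofNat] at h1
      have := hneg h
      omega
    · have h1 := hstar1 hy
      have h2 := hstar2 hx
      rw [hmix hxy h hx hy, h, sum_pair hxy]
      omega

/-! ### Cycle edges and the choice of parameters -/

/-- A cycle on the first `m` points, with some edges removed. -/
theorem exists_cyclic_pairs {n m k : ℕ} (hm : 3 ≤ m) (hmn : m ≤ n) (hk : k ≤ m) :
    ∃ T : Finset (Pair n), #T = k ∧ (∀ v ∈ T, ∀ x ∈ v.1, x.val < m) ∧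
      ∀ x, #{v ∈ T | x ∈ v.1} ≤ 2 := by
  obtain ⟨m, rfl⟩ := Nat.exists_eq_add_of_le' hm
  have h1 (i : Fin (m + 3)) : i ≠ i + 1 := by simp
  -- Length at least 3 keeps the edges at i and i + 1 distinct.
  have h2 (i : Fin (m + 3)) : i + 1 + 1 ≠ i := by
    rw [add_assoc, Ne, add_eq_left]
    simp only [Fin.ext_iff, Fin.val_add, Fin.val_one, Fin.val_zero]
    rw [Nat.mod_eq_of_lt (by omega)]
    norm_num
  have hinj := Fin.castLE_injective hmn
  let c (i : Fin (m + 3)) : Pair n :=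
    ⟨{Fin.castLE hmn i, Fin.castLE hmn (i + 1)}, card_pair (hinj.ne (h1 i))⟩
  have hc {i : Fin (m + 3)} {x : Fin n} :
      x ∈ (c i).1 ↔ x = Fin.castLE hmn i ∨ x = Fin.castLE hmn (i + 1) := by
    simp [c]
  have hcinj : Function.Injective c := by
    intro i j hij
    have hi : Fin.castLE hmn i ∈ (c j).1 := hij ▸ hc.2 (.inl rfl)
    have hi' : Fin.castLE hmn (i + 1) ∈ (c j).1 := hij ▸ hc.2 (.inr rfl)
    rw [hc, hinj.eq_iff, hinj.eq_iff] at hi hi'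
    rcases hi with h | h
    · exact h
    · subst h
      rcases hi' with h | h
      · exact absurd h (h2 j)
      · exact add_right_cancel h
  obtain ⟨I, -, hI⟩ := exists_subset_card_eq (s := (univ : Finset (Fin (m + 3)))) (n := k)
    (by simpa using hk)
  refine ⟨I.image c, by rw [card_image_of_injective _ hcinj, hI], ?_, fun x => ?_⟩
  · intro v hv x hx
    obtain ⟨i, -, rfl⟩ := mem_image.1 hv
    rcases hc.1 hx with rfl | rfl
    · exact i.isLt
    · exact (i + 1).isLt
  · have hsub : ({v ∈ I.image c | x ∈ v.1} : Finset (Pair n)) ⊆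
        ((univ.filter fun i => x = Fin.castLE hmn i) ∪
          univ.filter fun i => x = Fin.castLE hmn (i + 1)).image c := by
      intro v hv
      rw [mem_filter, mem_image] at hv
      obtain ⟨⟨i, -, rfl⟩, hx⟩ := hv
      refine mem_image_of_mem _ ?_
      simpa using hc.1 hx
    refine (card_le_card hsub).trans (card_image_le.trans ((card_union_le _ _).trans ?_))
    refine Nat.add_le_add (b := 1) (d := 1) ?_ ?_ <;> refine card_le_one.2 fun i hi j hj => ?_ <;>
      rw [mem_filter] at hi hj
    · exact hinj (hi.2.symm.trans hj.2)
    · exact add_right_cancel (hinj (hi.2.symm.trans hj.2))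

/-- An upper bound from a partition of the points into `m` negative and `m + t` positive ones. -/
theorem signedRomanDominationNumber_le {m t k : ℕ} {W : ℤ} (hm : 3 ≤ m) (hk : k ≤ m)
    (hk3 : 3 ≤ k) (hWeq : 2 * W = (t : ℤ) ^ 2 - (m + (m + t)) + 2 * k) (hW : 3 ≤ W)
    (hWt : 2 * (t : ℤ) ≤ W + 3) :
    signedRomanDominationNumber (kneserGraph (m + (m + t)) 2) ≤ W := by
  obtain ⟨T, hTk, hTm, hdeg⟩ := exists_cyclic_pairs (n := m + (m + t)) hm (by omega) hk
  let ε (x : Fin (m + (m + t))) : ℤ := if x.val < m then -1 else 1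
  have hε (x) : ε x = 1 ∨ ε x = -1 := by
    by_cases h : x.val < m <;> simp [ε, h]
  have hS : ∑ x, ε x = t := by
    rw [Fin.sum_univ_add]
    simp [ε]
  have hsum : ∑ v, label ε T v = W := by
    have h := two_mul_sum_label hε T
    rw [hS, hTk] at h
    push_cast at h
    omega
  refine (signedRomanDominationNumber_isLeast _).2 ⟨label ε T, ?_, hsum⟩
  refine isSignedRomanDominating_label hε (fun v hv x hx => if_pos (hTm v hv x hx)) hdeg
    (by omega) ?_ ?_ ?_
  all_goals omega

end KneserTwo

theorem theorem4 (n : ℕ) (hn : 12 ≤ n) :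
    (Odd n → 2 ≤ signedRomanDominationNumber (kneserGraph n 2) ∧
      signedRomanDominationNumber (kneserGraph n 2) ≤ 3) ∧
    (Even n → 2 ≤ signedRomanDominationNumber (kneserGraph n 2) ∧
      signedRomanDominationNumber (kneserGraph n 2) ≤ 5) := by
  have hlow : 2 ≤ signedRomanDominationNumber (kneserGraph n 2) := by
    obtain ⟨f, hf, hw⟩ := (signedRomanDominationNumber_isLeast (kneserGraph n 2)).1
    exact hw ▸ KneserTwo.two_le_weight (by omega) f hf.one_le_sum
  refine ⟨fun h => ⟨hlow, ?_⟩, fun h => ⟨hlow, ?_⟩⟩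
  -- Sign sum t = 3 and the full cycle give W = 3, with equality in 2t ≤ W + 3.
  · obtain ⟨m, rfl⟩ : ∃ m, n = m + (m + 3) := by
      obtain ⟨r, rfl⟩ := h
      exact ⟨r - 1, by omega⟩
    exact KneserTwo.signedRomanDominationNumber_le (k := m) (by omega) le_rfl (by omega)
      (by push_cast; ring) le_rfl (by norm_num)
  -- Here t = 4, and the full cycle would give W = 6. Dropping one edge gives W = 5, again with
  -- equality in 2t ≤ W + 3.
  · obtain ⟨m, rfl⟩ : ∃ m, n = m + 1 + (m + 1 + 4) := by
      obtain ⟨r, rfl⟩ := h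
      exact ⟨r - 3, by omega⟩
    exact KneserTwo.signedRomanDominationNumber_le (k := m) (by omega) (by omega) (by omega)
      (by push_cast; ring) (by norm_num) (by norm_num)
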